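/- **Setting.** A rooted measured space $G=(F,R,\rho,\mu)$ consists of a boundedly compact metric space $(F,R)$ (closed bounded sets are compact), a point $\rho\in F$, and a Radon measure $\mu$ on $F$ (a Borel measure finite on compact sets). Write $B_R(x,u)$ and $D_R(x,u)$ for the open and closed balls, let $F^{(r)}$ be the closure of $B_R(\rho,r)$, and let $N(F^{(r)},\varepsilon)$ be the minimal number of points of $F^{(r)}$ whose closed $\varepsilon$-balls cover $F^{(r)}$. Spaces that differ by a root- and measure-preserving isometry are identified. The Gromov–Hausdorff-vague topology is the one induced by $$d(G_1,G_2)=\int_0^\infty e^{-r}\bigl(1\wedge d_{c}(\overline G_1^{(r)},\overline G_2^{(r)})\bigr)\,dr,$$ where $\overline G^{(r)}$ is the restriction of $G$ to $D_R(\rho,r)$ and, for compact spaces, $d_c(K_1,K_2)$ is the infimum, over all isometric embeddings of $K_1,K_2$ into a common compact metric space, of the maximum of the Hausdorff distance of the images, the distance of the images of the roots and the Prohorov distance of the push-forward measures. Random elements and convergence in distribution refer to the Borel $\sigma$-algebra and weak convergence for this topology. Let $\mathbb F$ be the class of those $G$ such that $\mu$ has full support and $R$ is the resistance metric $R(x,y)=\sup\{|f(x)-f(y)|^2/\mathcal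 E(f,f): f\in\mathcal F,\ \mathcal E(f,f)>0\}$ of a regular resistance form $(\mathcal E,\mathcal F)$ on $F$ whose associated Dirichlet form on $L^2(F,\mu)$ is recurrent. Let $\check{\mathbb F}$ be the class of $G\in\mathbb F$ such that for every $r>0$ there is $\alpha\in(0,1/2)$ with $\sum_{k\ge1}N(F^{(r)},2^{-k})^2\exp(-2^{\alpha k})<\infty$. For random spaces $G_n=(F_n,R_n,\rho_n,\mu_n)$ on probability spaces with measures $\mathbf P_n$, the *annealed metric-entropy condition* is: for every $r>0$ there is $\alpha_r\in(0,1/2)$ such that for all $\varepsilon>0$ $$\lim_{m\to\infty}\limsup_{n\to\infty}\mathbf P_n\Bigl(\sum_{k\ge m}N(F_n^{(r)},2^{-k})^2\exp(-2^{\alpha_r k})\ge\varepsilon\Bigr)=0 .$$ **(a)** Let $G_n=(F_n,R_n,\rho_n,\mu_n)$ be random elements of $\check{\mathbb F}$ converging in distribution in the Gromov–Hausdorff-vague topology to a random element $G$ of $\mathbb F$. Suppose that there are $r_k>0$ with $r_k\to\infty$ and $\alpha_k\in(0,1/2)$ such that for every $\varepsilon>0$ there are measurable functions $v_{n,k}^\varepsilon:(0,\infty)\to(0,\infty)$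 with, for all $k$, $$\liminf_{n\to\infty}\mathbf P_n\Bigl(\inf_{x\in B_{R_n}(\rho_n,r_k)}\mu_n(D_{R_n}(x,u))\ge v_{n,k}^\varepsilon(u)\ \ \forall u>0\Bigr)\ge1-\varepsilon,$$ $$\lim_{m\to\infty}\limsup_{n\to\infty}\sum_{l\ge m}v_{n,k}^\varepsilon(2^{-l})^{-2}\exp(-2^{\alpha_k l})=0 .$$ Then $(G_n)$ satisfies the annealed metric-entropy condition. **(b)** Let $(F_n,R_n,\rho_n,\mu_n)$ be random spaces that take values in $\mathbb F$, with $F_n$ finite or countably infinite and $\mu_n$ the counting measure on $F_n$. Let $a_n,b_n>0$ be deterministic with $a_n\to\infty$, $b_n\to\infty$, and suppose that $G_n=(F_n,a_n^{-1}R_n,\rho_n,b_n^{-1}\mu_n)$ are random elements converging in distribution in the Gromov–Hausdorff-vague topology to a random element $G$ of $\mathbb F$. Suppose that there are deterministic $r_k>0$ with $r_k\to\infty$, $c_{n,k}>0$ and $\alpha_k\in(0,1/2)$ such that $b_n^2\exp(-c_{n,k}^{\alpha_k})\to0$ as $n\to\infty$ for every $k$, and such that for every $\varepsilon>0$ there are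 constants $c'_{\varepsilon,k}>0$ and measurable functions $v_k^\varepsilon:(0,\infty)\to(0,\infty)$ with, for all $k$, $$\liminf_{n\to\infty}\mathbf P_n\Bigl(\inf_{x\in B_{R_n}(\rho_n,a_nr_k)}b_n^{-1}\mu_n(D_{R_n}(x,a_nu))\ge v_k^\varepsilon(u)\ \ \forall u\in(c_{n,k}^{-1},c'_{\varepsilon,k})\Bigr)\ge1-\varepsilon,$$ $$\sum_{l}v_k^\varepsilon(2^{-l})^{-2}\exp(-2^{\alpha_kl})<\infty .$$ Then $(G_n)$ satisfies the annealed metric-entropy condition. -/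

import Mathlib

open MeasureTheory Filter Topology Set
open scoped ENNReal NNReal

universe u v w

noncomputable section

/-! ### Resistance forms -/

/-- A resistance form `(𝓔, 𝓕)` on a set `F`: `dom` is `𝓕`, `form` is `𝓔`. -/
structure ResistanceForm (F : Type u) where
  /-- The domain, a linear space of real functions on `F`. -/
  dom : Submodule ℝ (F → ℝ)
  /-- The bilinear form. -/
  form : dom →ₗ[ℝ] dom →ₗ[ℝ] ℝ
  const_mem : ∀ c : ℝ, (fun _ : F => c) ∈ dom
  symm : ∀ f g : dom, form f g = form g f
  nonneg : ∀ f : dom, 0 ≤ form f f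
  form_self_eq_zero : ∀ f : dom, form f f = 0 ↔ ∃ c : ℝ, ∀ x, (f : F → ℝ) x = c
  /-- `(𝓕/constants, 𝓔)` is a Hilbert space: `𝓔`-Cauchy sequences converge. -/
  complete : ∀ f : ℕ → dom,
    (∀ ε > 0, ∃ N, ∀ m ≥ N, ∀ n ≥ N, form (f m - f n) (f m - f n) < ε) →
    ∃ g : dom, Tendsto (fun n => form (f n - g) (f n - g)) atTop (𝓝 0)
  separates : ∀ x y : F, x ≠ y → ∃ f : dom, (f : F → ℝ) x ≠ (f : F → ℝ) y
  bddAbove : ∀ x y : F, BddAbove {t : ℝ | ∃ f : dom, 0 < form f f ∧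
    t = |(f : F → ℝ) x - (f : F → ℝ) y| ^ 2 / form f f}
  markov : ∀ f : dom, ∃ h : (fun x => max (min ((f : F → ℝ) x) 1) 0) ∈ dom,
    form ⟨_, h⟩ ⟨_, h⟩ ≤ form f f

namespace ResistanceForm

/-- The resistance metric
`R(x, y) = sup {|f x - f y|² / 𝓔(f, f) : f ∈ 𝓕, 𝓔(f, f) > 0}` of a resistance form
(the supremum of the empty set, which occurs only when `F` has one point, is `0`). -/
def resistance {F : Type u} (E : ResistanceForm F) (x y : F) : ℝ :=
  sSup {t : ℝ | ∃ f : E.dom, 0 < E.form f f ∧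
    t = |(f : F → ℝ) x - (f : F → ℝ) y| ^ 2 / E.form f f}

variable {F : Type u} [MetricSpace F]

/-- Regularity: `𝓕 ∩ C_c(F)` is dense in `C_c(F)` for the supremum norm. -/
def IsRegular (E : ResistanceForm F) : Prop :=
  ∀ g : F → ℝ, Continuous g → HasCompactSupport g → ∀ ε > 0,
    ∃ f : E.dom, Continuous (f : F → ℝ) ∧ HasCompactSupport (f : F → ℝ) ∧
      ∀ x, |(f : F → ℝ) x - g x| ≤ ε

variable [MeasurableSpace F]

/-- The domain `𝓓` of the Dirichlet form on `L²(F, μ)`: the closure of `𝓕 ∩ C_c(F)` in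
`𝓕 ∩ L²(F, μ)` with respect to `𝓔₁(f, f) = 𝓔(f, f) + ∫ f² dμ`. -/
def dirichletDomain (E : ResistanceForm F) (μ : Measure F) : Set E.dom :=
  {f | MemLp (f : F → ℝ) 2 μ ∧ ∀ ε > 0, ∃ g : E.dom,
    Continuous (g : F → ℝ) ∧ HasCompactSupport (g : F → ℝ) ∧
    E.form (f - g) (f - g) + ∫ x, ((f : F → ℝ) x - (g : F → ℝ) x) ^ 2 ∂μ < ε}

/-- Recurrence of the Dirichlet form `(𝓔, 𝓓)`: the constant function `1` belongs to the extended
Dirichlet space and `𝓔(1, 1) = 0`, that is, there are `f n ∈ 𝓓` with `f n → 1` `μ`-a.e. and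
`𝓔(f n, f n) → 0` (such a sequence is automatically `𝓔`-Cauchy). -/
def IsRecurrent (E : ResistanceForm F) (μ : Measure F) : Prop :=
  ∃ f : ℕ → E.dom, (∀ n, f n ∈ E.dirichletDomain μ) ∧
    (∀ᵐ x ∂μ, Tendsto (fun n => (f n : F → ℝ) x) atTop (𝓝 1)) ∧
    Tendsto (fun n => E.form (f n) (f n)) atTop (𝓝 0)

end ResistanceForm

/-! ### Rooted measured spaces and the Gromov-Hausdorff-vague topology -/

/-- The metric `a * d`, with the same topology. -/
@[reducible] def scaledMetric {X : Type u} (d : MetricSpace X) (a : ℝ) (ha : 0 < a) :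
    MetricSpace X where
  dist x y := a * dist x y
  dist_self x := by simp
  dist_comm x y := by simp [dist_comm]
  dist_triangle x y z := by
    rw [← mul_add]
    exact mul_le_mul_of_nonneg_left (dist_triangle x y z) ha.le
  eq_of_dist_eq_zero {x y} h := by
    rcases mul_eq_zero.1 h with h | h
    · exact absurd h ha.ne'
    · exact dist_eq_zero.1 h
  toUniformSpace := d.toUniformSpace
  uniformity_dist := by
    refine (Metric.uniformity_basis_dist.ext
      (hasBasis_biInf_principal (S := Ioi (0 : ℝ)) ?_ ⟨1, mem_Ioi.2 one_pos⟩) ?_ ?_)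
    · intro x hx y hy
      exact ⟨min x y, mem_Ioi.2 (lt_min (mem_Ioi.1 hx) (mem_Ioi.1 hy)),
        fun p hp => lt_of_lt_of_le hp (min_le_left x y),
        fun p hp => lt_of_lt_of_le hp (min_le_right x y)⟩
    · intro ε hε
      exact ⟨a * ε, mul_pos ha hε, fun p hp => lt_of_mul_lt_mul_left hp ha.le⟩
    · intro ε hε
      exact ⟨ε / a, div_pos hε ha, fun p hp => by
        have h : dist p.1 p.2 < ε / a := hp
        rw [lt_div_iff₀ ha, mul_comm] at h
        exact h⟩
  toBornology := d.toBornology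
  cobounded_sets := by
    ext s
    change Bornology.IsCobounded s ↔ ∃ C, ∀ x ∈ sᶜ, ∀ y ∈ sᶜ, a * dist x y ≤ C
    rw [← Bornology.isBounded_compl_iff, Metric.isBounded_iff]
    constructor
    · rintro ⟨C, hC⟩
      exact ⟨a * C, fun x hx y hy => mul_le_mul_of_nonneg_left (hC hx hy) ha.le⟩
    · rintro ⟨C, hC⟩
      refine ⟨C / a, fun x hx y hy => ?_⟩
      rw [le_div_iff₀ ha, mul_comm]
      exact hC x hx y hy

theorem properSpace_scaledMetric {X : Type u} (d : MetricSpace X) [ProperSpace X] (a : ℝ)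
    (ha : 0 < a) : @ProperSpace X (scaledMetric d a ha).toPseudoMetricSpace := by
  refine @ProperSpace.mk X (scaledMetric d a ha).toPseudoMetricSpace fun x r => ?_
  have h : @Metric.closedBall X (scaledMetric d a ha).toPseudoMetricSpace x r
      = Metric.closedBall x (r / a) := by
    ext y
    change a * dist y x ≤ r ↔ dist y x ≤ r / a
    rw [le_div_iff₀ ha, mul_comm]
  rw [h]
  exact isCompact_closedBall x (r / a)

/-- A rooted boundedly-compact metric space with a Radon measure (a Borel measure that is finite on
compact sets). Spaces related by a root- and measure-preserving isometry are not identified here;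
they have distance `0` below and cannot be separated by any open set. -/
structure RMSpace : Type (u + 1) where
  carrier : Type u
  [metric : MetricSpace carrier]
  [proper : ProperSpace carrier]
  [meas : MeasurableSpace carrier]
  [borel : BorelSpace carrier]
  root : carrier
  vol : Measure carrier
  [finite : IsFiniteMeasureOnCompacts vol]

namespace RMSpace

attribute [instance] RMSpace.metric RMSpace.proper RMSpace.meas RMSpace.borel RMSpace.finite

/-- The restriction of a space to the closed ball of radius `r` around the root. -/
def restrict (G : RMSpace.{u}) (r : ℝ≥0) : RMSpace.{u} :=
  haveI : ProperSpace (Metric.closedBall G.root r) :=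
    haveI := isCompact_iff_compactSpace.1 (isCompact_closedBall G.root (r : ℝ))
    inferInstance
  haveI : IsFiniteMeasureOnCompacts
      (G.vol.comap (Subtype.val : Metric.closedBall G.root (r : ℝ) → G.carrier)) := by
    refine ⟨fun K hK => ?_⟩
    rw [(MeasurableEmbedding.subtype_coe
      Metric.isClosed_closedBall.measurableSet).comap_apply]
    exact (hK.image continuous_subtype_val).measure_lt_top
  { carrier := Metric.closedBall G.root (r : ℝ)
    root := ⟨G.root, Metric.mem_closedBall_self r.2⟩
    vol := G.vol.comap Subtype.val }

/-- The space with metric multiplied by `a` and measure multiplied by `b`. -/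
def rescale (G : RMSpace.{u}) (a b : ℝ) (ha : 0 < a) : RMSpace.{u} :=
  haveI : IsFiniteMeasureOnCompacts (ENNReal.ofReal b • G.vol) := by
    refine ⟨fun K hK => ?_⟩
    rw [Measure.smul_apply, smul_eq_mul]
    exact ENNReal.mul_lt_top ENNReal.ofReal_lt_top hK.measure_lt_top
  @RMSpace.mk G.carrier (scaledMetric G.metric a ha) (properSpace_scaledMetric G.metric a ha)
    G.meas G.borel G.root (ENNReal.ofReal b • G.vol) this

/-- The Gromov-Hausdorff-Prohorov distance: the infimum, over isometric embeddings of the two spaces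
into a common compact metric space, of the maximum of the Hausdorff distance of the images, the
distance of the roots and the Prohorov distance of the push-forward measures. -/
def ghpDist (G₁ G₂ : RMSpace.{u}) : ℝ≥0∞ :=
  ⨅ (Z : Type u) (_ : MetricSpace Z) (_ : CompactSpace Z) (_ : MeasurableSpace Z)
    (_ : BorelSpace Z) (f₁ : G₁.carrier → Z) (f₂ : G₂.carrier → Z)
    (_ : Isometry f₁) (_ : Isometry f₂),
    max (Metric.hausdorffEDist (range f₁) (range f₂))
      (max (edist (f₁ G₁.root) (f₂ G₂.root))
        (levyProkhorovEDist (G₁.vol.map f₁) (G₂.vol.map f₂)))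

/-- The distance
`∫₀^∞ e^{-r} (1 ∧ d(G₁ restricted to radius r, G₂ restricted to radius r)) dr`. -/
def ghvDist (G₁ G₂ : RMSpace.{u}) : ℝ≥0∞ :=
  ∫⁻ r in Ioi (0 : ℝ), ENNReal.ofReal (Real.exp (-r)) *
    min 1 (ghpDist (G₁.restrict r.toNNReal) (G₂.restrict r.toNNReal))

/-- The Gromov-Hausdorff-vague topology: the topology induced by `ghvDist`, whose open sets are
those that contain a `ghvDist`-ball around each of their points. -/
instance : TopologicalSpace RMSpace.{u} where
  IsOpen U := ∀ G ∈ U, ∃ ε > 0, ∀ G', ghvDist G G' < ε → G' ∈ U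
  isOpen_univ := fun _ _ => ⟨1, one_pos, fun _ _ => mem_univ _⟩
  isOpen_inter := by
    rintro U V hU hV G ⟨h₁, h₂⟩
    obtain ⟨ε₁, hε₁, H₁⟩ := hU G h₁
    obtain ⟨ε₂, hε₂, H₂⟩ := hV G h₂
    exact ⟨min ε₁ ε₂, lt_min hε₁ hε₂, fun G' h =>
      ⟨H₁ G' (h.trans_le (min_le_left _ _)), H₂ G' (h.trans_le (min_le_right _ _))⟩⟩
  isOpen_sUnion := by
    rintro S hS G ⟨U, hU, hG⟩
    obtain ⟨ε, hε, H⟩ := hS U hU G hG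
    exact ⟨ε, hε, fun G' h => ⟨U, hU, H G' h⟩⟩

instance : MeasurableSpace RMSpace.{u} := _root_.borel _

instance : BorelSpace RMSpace.{u} := ⟨rfl⟩

/-- The class `𝔽`: the measure has full support, and the metric is the resistance metric of a
regular resistance form whose Dirichlet form is recurrent. -/
def IsResistanceSpace (G : RMSpace.{u}) : Prop :=
  G.vol.IsOpenPosMeasure ∧ ∃ E : ResistanceForm G.carrier,
    (∀ x y, dist x y = E.resistance x y) ∧ E.IsRegular ∧ E.IsRecurrent G.vol

/-- The tail `∑_{k ≥ m} N(F^{(r)}, 2^{-k})² exp(-2^{α k})`, where `F^{(r)}` is the closure of the open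
ball of radius `r` around the root and `N(F^{(r)}, ε)` is the smallest number of points of `F^{(r)}`
whose closed `ε`-balls cover `F^{(r)}`. -/
def entropyTail (G : RMSpace.{u}) (r α : ℝ) (m : ℕ) : ℝ≥0∞ :=
  ∑' k : {k : ℕ // m ≤ k},
    ((Metric.coveringNumber ((2 : ℝ≥0)⁻¹ ^ (k : ℕ)) (closure (Metric.ball G.root r)) : ℕ∞) : ℝ≥0∞) ^ 2
      * ENNReal.ofReal (Real.exp (-(2 : ℝ) ^ (α * (k : ℕ))))

/-- The class `𝔽` with a check: spaces in `𝔽` such that for every `r > 0` there is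
`α ∈ (0, 1/2)` with `∑_{k ≥ 1} N(F^{(r)}, 2^{-k})² exp(-2^{α k}) < ∞`. -/
def IsEntropicResistanceSpace (G : RMSpace.{u}) : Prop :=
  G.IsResistanceSpace ∧ ∀ r > 0, ∃ α ∈ Ioo (0 : ℝ) (1 / 2), G.entropyTail r α 1 < ∞

end RMSpace

/-! ### The conditions on sequences of random spaces -/

section Conditions

variable {Ω : ℕ → Type v} [∀ n, MeasurableSpace (Ω n)] (P : ∀ n, Measure (Ω n))

/-- The annealed metric-entropy condition. -/
def AnnealedEntropyCondition (G : ∀ n, Ω n → RMSpace.{u}) : Prop :=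
  ∀ r > 0, ∃ α ∈ Ioo (0 : ℝ) (1 / 2), ∀ ε : ℝ, 0 < ε →
    Tendsto (fun m : ℕ => limsup (fun n : ℕ =>
      P n {ω | ENNReal.ofReal ε ≤ (G n ω).entropyTail r α m}) atTop) atTop (𝓝 0)

/-- The volume condition, with bounds `v n k` allowed to depend on `ε` (radii range over `u > 0`; the
values of `v` at `u ≤ 0` are irrelevant). -/
def VolumeCondition (G : ∀ n, Ω n → RMSpace.{u}) : Prop :=
  ∃ (r α : ℕ → ℝ), (∀ k, 0 < r k) ∧ Tendsto r atTop atTop ∧ (∀ k, α k ∈ Ioo (0 : ℝ) (1 / 2)) ∧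
    ∀ ε : ℝ, 0 < ε → ∃ v : ℕ → ℕ → ℝ → ℝ,
      (∀ n k, Measurable (v n k)) ∧ (∀ n k u, 0 < u → 0 < v n k u) ∧
      (∀ k, ENNReal.ofReal (1 - ε) ≤ liminf (fun n : ℕ => P n {ω | ∀ u : ℝ, 0 < u →
        ENNReal.ofReal (v n k u) ≤ ⨅ x ∈ Metric.ball (G n ω).root (r k),
          (G n ω).vol (Metric.closedBall x u)}) atTop) ∧
      ∀ k, Tendsto (fun m : ℕ => limsup (fun n : ℕ => ∑' l : {l : ℕ // m ≤ l},
        ENNReal.ofReal ((v n k (2⁻¹ ^ (l : ℕ)))⁻¹ ^ 2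
          * Real.exp (-(2 : ℝ) ^ (α k * (l : ℕ))))) atTop) atTop (𝓝 0)

/-- The volume condition for unscaled graphs `H n` with scaling factors `a n` for the metric and `b n`
for the measure: bounds for radii of order down to `a n / c n k`. -/
def GraphVolumeCondition (H : ∀ n, Ω n → RMSpace.{u}) (a b : ℕ → ℝ) : Prop :=
  ∃ (r : ℕ → ℝ) (c : ℕ → ℕ → ℝ) (α : ℕ → ℝ),
    (∀ k, 0 < r k) ∧ Tendsto r atTop atTop ∧ (∀ n k, 0 < c n k) ∧
    (∀ k, α k ∈ Ioo (0 : ℝ) (1 / 2)) ∧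
    (∀ k, Tendsto (fun n => b n ^ 2 * Real.exp (-(c n k ^ α k))) atTop (𝓝 0)) ∧
    ∀ ε : ℝ, 0 < ε → ∃ (c' : ℕ → ℝ) (v : ℕ → ℝ → ℝ),
      (∀ k, 0 < c' k) ∧ (∀ k, Measurable (v k)) ∧ (∀ k u, 0 < u → 0 < v k u) ∧
      (∀ k, ENNReal.ofReal (1 - ε) ≤ liminf (fun n : ℕ => P n {ω | ∀ u ∈ Ioo (c n k)⁻¹ (c' k),
        ENNReal.ofReal (v k u) ≤ ⨅ x ∈ Metric.ball (H n ω).root (a n * r k),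
          ENNReal.ofReal (b n)⁻¹ * (H n ω).vol (Metric.closedBall x (a n * u))}) atTop) ∧
      ∀ k, Summable (fun l : ℕ => (v k (2⁻¹ ^ l))⁻¹ ^ 2 * Real.exp (-(2 : ℝ) ^ (α k * l)))

end Conditions

end

/-!
The entropy of a ball is controlled by packing it with small balls of known minimal volume, and the
total volume available for the packing is tight by convergence in distribution.

*Packing.* A maximal `2⁻ˡ`-separated subset of `F^{(r)}` is a `2⁻ˡ`-cover, and the closed balls of
radius `2⁻⁽ˡ⁺¹⁾` around its points are disjoint and contained in `D(ρ, r + 1)`. If all these balls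
have volume at least `v(2⁻⁽ˡ⁺¹⁾)`, then `N(F^{(r)}, 2⁻ˡ) ≤ μ(D(ρ, r + 1)) / v(2⁻⁽ˡ⁺¹⁾)`
(`RMSpace.coveringNumber_mul_minVol_le`). The shift of `l` by one is absorbed by passing from the
exponent `α_k` to a larger `α < 1/2` (`exists_forall_two_rpow_add_le`). So the tail of the entropy
series is at most `μ(D(ρ, r + 1))²` times the tail of the series in the volume condition. For a
multiple of the counting measure, `N` is also at most the number of points of `F^{(r)}`, which is at
most `b_n μ(D(ρ, r + 1))`; this handles the scales below `1 / c_{n,k}`, whose total contribution is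
at most a constant times `μ(D(ρ, r + 1))² b_n² exp(-c_{n,k}^{α_k})`.

*Tightness.* It remains to know that `μ_n(D(ρ_n, r + 1))` is tight. The volume of a ball is not a
continuous function of the space, but
`ψ_M(G) = inf_{s ≥ 0} (s + (M - μ(D(ρ, s)))⁺)` is (`RMSpace.continuous_toReal_volumeProfile`): an
inequality `μ(D(ρ, s)) ≤ μ'(D(ρ', s + 2δ)) + δ` changes the infimum by at most `3δ`. Since
`ψ_M ≤ r` when `μ(D(ρ, r)) ≥ M`, and `ψ_M(G) > r` for `M` large depending on `G`, the portmanteau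
theorem for `ψ_M(G_n)` gives tightness.

*Measurability.* The probabilities in the statement are outer measures, so a lower bound for the
probability of the volume event bounds the probability of its complement only if the event is
measurable. It is: `G ↦ inf_{x ∈ B(ρ, r)} μ(D(x, u))` is upper semicontinuous
(`RMSpace.isOpen_minVol_lt`), so the volume event is the preimage of a closed set, even though it
involves uncountably many `u`.

By definition of the topology, a set is open once it contains a `ghvDist`-ball around each of its
points; the triangle inequality for `ghvDist` is never needed.
-/

noncomputable section

/-! ### Series and exponents -/

/-- The larger exponent absorbs both the shift of the index and a factor `exp (-l)`, which makes the
terms summable at the scales where no volume bound is available. -/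
theorem exists_forall_two_rpow_add_le {β α : ℝ} (hβ : 0 < β) (hα : β < α) :
    ∃ m₀ : ℕ, ∀ l ≥ m₀, (2 : ℝ) ^ (β * (l + 1 : ℕ)) + l ≤ 2 ^ (α * (l : ℕ)) := by
  have hp : (0 : ℝ) ≤ 2 ^ β := by positivity
  have hpq : (2 : ℝ) ^ β < 2 ^ α := Real.rpow_lt_rpow_of_exponent_lt one_lt_two hα
  have hq : (1 : ℝ) < 2 ^ α := Real.one_lt_rpow one_lt_two (hβ.trans hα)
  have h1 := ((isLittleO_pow_pow_of_lt_left hp hpq).const_mul_left (2 ^ β)).add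
    (isLittleO_coe_const_pow_of_one_lt (R := ℝ) hq)
  obtain ⟨m₀, hm₀⟩ := eventually_atTop.1 (h1.def one_pos)
  refine ⟨m₀, fun l hl => ?_⟩
  have h2 := hm₀ l hl
  rw [one_mul, Real.norm_of_nonneg (by positivity), Real.norm_of_nonneg (by positivity)] at h2
  rwa [Real.rpow_mul two_pos.le, Real.rpow_mul two_pos.le, Real.rpow_natCast, Real.rpow_natCast,
    pow_succ']

theorem sq_mul_ofReal_exp_le {N V w : ℝ≥0∞} {x y z : ℝ} (hN : N ≤ V * w) (h : y + z ≤ x) :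
    N ^ 2 * ENNReal.ofReal (Real.exp (-x))
      ≤ V ^ 2 * (w ^ 2 * ENNReal.ofReal (Real.exp (-y)) * ENNReal.ofReal (Real.exp (-z))) := by
  calc _ ≤ (V * w) ^ 2 * ENNReal.ofReal (Real.exp (-y) * Real.exp (-z)) := by
        gcongr
        rw [← Real.exp_add]
        gcongr
        linarith
    _ = _ := by rw [ENNReal.ofReal_mul (Real.exp_pos _).le]; ring

theorem tsum_succ_le (w : ℕ → ℝ≥0∞) (m : ℕ) :
    ∑' l : {l : ℕ // m ≤ l}, w (l + 1) ≤ ∑' l : {l : ℕ // m ≤ l}, w l :=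
  ENNReal.tsum_comp_le_tsum_of_injective
    (f := fun l : {l : ℕ // m ≤ l} => (⟨l + 1, l.2.trans l.1.le_succ⟩ : {l : ℕ // m ≤ l}))
    (fun a b hab => Subtype.ext (by simpa using hab)) (fun l => w l)

theorem tendsto_tsum_ge {w : ℕ → ℝ≥0∞} (hw : ∑' l, w l ≠ ∞) :
    Tendsto (fun m => ∑' l : {l : ℕ // m ≤ l}, w l) atTop (𝓝 0) := by
  refine tendsto_of_tendsto_of_tendsto_of_le_of_le tendsto_const_nhds
    (ENNReal.tendsto_sum_nat_add w hw) (fun _ => zero_le) fun m => ?_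
  calc ∑' l : {l : ℕ // m ≤ l}, w l = ∑' l : {l : ℕ // m ≤ l}, w ((l - m) + m) := by
        refine tsum_congr fun l => ?_
        rw [Nat.sub_add_cancel l.2]
    _ ≤ _ := ENNReal.tsum_comp_le_tsum_of_injective
        (f := fun l : {l : ℕ // m ≤ l} => l.1 - m)
        (fun a b hab => Subtype.ext (by have := a.2; have := b.2; simp only at hab; omega))
        (fun k => w (k + m))

/-! ### A consequence of convergence in distribution -/

theorem MeasureTheory.TendstoInDistribution.limsup_measure_le_of_continuous
    {E : Type*} [TopologicalSpace E] [MeasurableSpace E] [OpensMeasurableSpace E]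
    {Ω : ℕ → Type v} [∀ n, MeasurableSpace (Ω n)]
    {P : ∀ n, Measure (Ω n)} [∀ n, IsProbabilityMeasure (P n)]
    {Ω' : Type w} [MeasurableSpace Ω'] {P' : Measure Ω'} [IsProbabilityMeasure P']
    {X : ∀ n, Ω n → E} {Z : Ω' → E}
    (h : TendstoInDistribution X atTop Z P P') {f : E → ℝ} (hf : Continuous f) (r : ℝ) :
    limsup (fun n => P n {ω | f (X n ω) ≤ r}) atTop ≤ P' {ω | f (Z ω) ≤ r} := by
  have h1 := h.continuous_comp hf
  have h2 := ProbabilityMeasure.limsup_measure_closed_le_of_tendsto h1.tendsto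
    (isClosed_Iic (a := r))
  simp only [ProbabilityMeasure.coe_mk] at h2
  rw [Measure.map_apply_of_aemeasurable h1.aemeasurable_limit measurableSet_Iic] at h2
  simp only [fun n => Measure.map_apply_of_aemeasurable (h1.forall_aemeasurable n)
    (measurableSet_Iic (a := r))] at h2
  exact h2

namespace RMSpace

/-! ### Comparison of balls in spaces that are close to each other -/

/-- Since `exp (-r)` is bounded below on `(R, R + 1)`, a small `ghvDist` forces the restrictions to
some radius in this interval to be close. -/
theorem exists_ghpDist_restrict_lt (R δ : ℝ) (hR : 0 ≤ R) (hδ : 0 < δ) :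
    ∃ ε > 0, ∀ G G' : RMSpace.{u}, ghvDist G G' < ε → ∃ s : ℝ≥0, R ≤ s ∧
      ghpDist (G.restrict s) (G'.restrict s) < ENNReal.ofReal δ := by
  refine ⟨ENNReal.ofReal (Real.exp (-(R + 1))) * min 1 (ENNReal.ofReal δ), ?_, ?_⟩
  · exact ENNReal.mul_pos (ENNReal.ofReal_pos.2 (Real.exp_pos _)).ne'
      (lt_min one_pos (ENNReal.ofReal_pos.2 hδ)).ne'
  intro G G' h
  by_contra! hcon
  refine absurd h (not_lt.2 ?_)
  calc ENNReal.ofReal (Real.exp (-(R + 1))) * min 1 (ENNReal.ofReal δ)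
      = ∫⁻ _ in Ioo R (R + 1), ENNReal.ofReal (Real.exp (-(R + 1))) * min 1 (ENNReal.ofReal δ) := by
        simp
    _ ≤ ∫⁻ r in Ioo R (R + 1), ENNReal.ofReal (Real.exp (-r)) *
          min 1 (ghpDist (G.restrict r.toNNReal) (G'.restrict r.toNNReal)) := by
        refine setLIntegral_mono' measurableSet_Ioo fun r hr => ?_
        gcongr
        · exact hr.2.le
        · exact hcon _ (by rw [Real.coe_toNNReal _ (hR.trans hr.1.le)]; exact hr.1.le)
    _ ≤ ghvDist G G' := lintegral_mono_set fun r hr => hR.trans_lt hr.1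

/-- The inclusion of a restricted space. -/
def restrictVal (G : RMSpace.{u}) (s : ℝ≥0) : (G.restrict s).carrier → G.carrier :=
  fun x => x.1

theorem isometry_restrictVal (G : RMSpace.{u}) (s : ℝ≥0) : Isometry (G.restrictVal s) :=
  fun _ _ => rfl

theorem vol_restrict_preimage (G : RMSpace.{u}) (s : ℝ≥0) (B : Set G.carrier) :
    (G.restrict s).vol (G.restrictVal s ⁻¹' B) = G.vol (B ∩ Metric.closedBall G.root s) := by
  have h : G.vol.comap (Subtype.val : Metric.closedBall G.root (s : ℝ) → G.carrier)
      (Subtype.val ⁻¹' B) = G.vol (B ∩ Metric.closedBall G.root s) := by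
    rw [(MeasurableEmbedding.subtype_coe
      Metric.isClosed_closedBall.measurableSet).comap_apply, Subtype.image_preimage_coe, inter_comm]
  exact h

/-- If the restrictions of two spaces are embedded in `Z` with Prohorov distance less than `δ`, and
the points `x` and `y` are sent to points at distance less than `δ`, then the volume of a ball
around `x` that lies in the restricted part is at most the volume of a ball around `y` with radius
larger by `2δ`, plus `δ`. -/
theorem vol_closedBall_le_of_embedding {G₁ G₂ : RMSpace.{u}} {s : ℝ≥0} {Z : Type u} [MetricSpace Z]
    [MeasurableSpace Z] [BorelSpace Z]
    {f₁ : (G₁.restrict s).carrier → Z} {f₂ : (G₂.restrict s).carrier → Z}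
    (hf₁ : Isometry f₁) (hf₂ : Isometry f₂) {δ : ℝ} (hδ : 0 < δ)
    (hLP : levyProkhorovEDist ((G₁.restrict s).vol.map f₁) ((G₂.restrict s).vol.map f₂)
      < ENNReal.ofReal δ)
    (x : (G₁.restrict s).carrier) (y : (G₂.restrict s).carrier)
    (hxy : edist (f₁ x) (f₂ y) < ENNReal.ofReal δ) (u : ℝ)
    (hu : dist (G₁.restrictVal s x) G₁.root + u ≤ s) :
    G₁.vol (Metric.closedBall (G₁.restrictVal s x) u)
      ≤ G₂.vol (Metric.closedBall (G₂.restrictVal s y) (u + 2 * δ)) + ENNReal.ofReal δ := by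
  have h := left_measure_le_of_levyProkhorovEDist_lt hLP
    (Metric.isClosed_closedBall (x := f₁ x) (ε := u)).measurableSet
  have hxy' : dist (f₁ x) (f₂ y) < δ := by
    rwa [edist_dist, ENNReal.ofReal_lt_ofReal_iff hδ] at hxy
  have h1 : G₁.vol (Metric.closedBall (G₁.restrictVal s x) u)
      ≤ (G₁.restrict s).vol.map f₁ (Metric.closedBall (f₁ x) u) := by
    rw [Measure.map_apply hf₁.continuous.measurable Metric.isClosed_closedBall.measurableSet]
    have e : f₁ ⁻¹' Metric.closedBall (f₁ x) u
        = G₁.restrictVal s ⁻¹' Metric.closedBall (G₁.restrictVal s x) u := by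
      rw [hf₁.preimage_closedBall, (G₁.isometry_restrictVal s).preimage_closedBall]
    rw [e, vol_restrict_preimage, inter_eq_left.2]
    intro z hz
    have := dist_triangle z (G₁.restrictVal s x) G₁.root
    rw [Metric.mem_closedBall] at hz ⊢
    linarith
  have h2 : (G₂.restrict s).vol.map f₂
        (Metric.thickening (ENNReal.ofReal δ).toReal (Metric.closedBall (f₁ x) u))
      ≤ G₂.vol (Metric.closedBall (G₂.restrictVal s y) (u + 2 * δ)) := by
    rw [ENNReal.toReal_ofReal hδ.le,
      Measure.map_apply hf₂.continuous.measurable Metric.isOpen_thickening.measurableSet]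
    refine (measure_mono (t := G₂.restrictVal s ⁻¹'
      Metric.closedBall (G₂.restrictVal s y) (u + 2 * δ)) ?_).trans ?_
    · intro z hz
      obtain ⟨p, hp, hzp⟩ := Metric.mem_thickening_iff.1 hz
      have := dist_triangle4 (f₂ z) p (f₁ x) (f₂ y)
      rw [Metric.mem_closedBall] at hp
      rw [mem_preimage, Metric.mem_closedBall, (G₂.isometry_restrictVal s).dist_eq,
        ← hf₂.dist_eq]
      linarith
    · rw [vol_restrict_preimage]
      exact measure_mono inter_subset_left
  exact h1.trans (h.trans (add_le_add_left h2 _))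

theorem levyProkhorov_data_of_ghpDist_lt {G₁ G₂ : RMSpace.{u}} {c : ℝ≥0∞} (h : ghpDist G₁ G₂ < c) :
    ∃ (Z : Type u) (_ : MetricSpace Z) (_ : MeasurableSpace Z) (_ : BorelSpace Z)
      (f₁ : G₁.carrier → Z) (f₂ : G₂.carrier → Z), Isometry f₁ ∧ Isometry f₂ ∧
      Metric.hausdorffEDist (range f₁) (range f₂) < c ∧ edist (f₁ G₁.root) (f₂ G₂.root) < c ∧
      levyProkhorovEDist (G₁.vol.map f₁) (G₂.vol.map f₂) < c := by
  simp only [ghpDist, iInf_lt_iff, max_lt_iff] at h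
  obtain ⟨Z, i₁, _, i₂, i₃, f₁, f₂, h₁, h₂, h₃, h₄, h₅⟩ := h
  exact ⟨Z, i₁, i₂, i₃, f₁, f₂, h₁, h₂, h₃, h₄, h₅⟩

/-- Comparison of balls around the roots of spaces that are close to each other. -/
theorem exists_forall_vol_closedBall_root_le (R δ : ℝ) (hR : 0 ≤ R) (hδ : 0 < δ) :
    ∃ ε > 0, ∀ G G' : RMSpace.{u}, ghvDist G G' < ε → ∀ u ≤ R,
      G.vol (Metric.closedBall G.root u)
        ≤ G'.vol (Metric.closedBall G'.root (u + 2 * δ)) + ENNReal.ofReal δ ∧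
      G'.vol (Metric.closedBall G'.root u)
        ≤ G.vol (Metric.closedBall G.root (u + 2 * δ)) + ENNReal.ofReal δ := by
  obtain ⟨ε, hε, H⟩ := exists_ghpDist_restrict_lt R δ hR hδ
  refine ⟨ε, hε, fun G G' h u hu => ?_⟩
  obtain ⟨s, hs, hsδ⟩ := H G G' h
  obtain ⟨Z, _, _, _, f₁, f₂, h₁, h₂, -, h₄, h₅⟩ := levyProkhorov_data_of_ghpDist_lt hsδ
  constructor
  · exact vol_closedBall_le_of_embedding h₁ h₂ hδ h₅ (G.restrict s).root (G'.restrict s).root h₄ u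
      ((congrArg (· + u) (dist_self _)).trans_le (by linarith))
  · rw [levyProkhorovEDist_comm] at h₅
    rw [edist_comm] at h₄
    exact vol_closedBall_le_of_embedding h₂ h₁ hδ h₅ (G'.restrict s).root (G.restrict s).root h₄ u
      ((congrArg (· + u) (dist_self _)).trans_le (by linarith))

/-- Every point of a space has a partner in each space close to it, at almost the same distance
from the root, around which balls do not have much larger volume. -/
theorem exists_forall_vol_closedBall_le (R δ : ℝ) (hR : 0 ≤ R) (hδ : 0 < δ) :
    ∃ ε > 0, ∀ G G' : RMSpace.{u}, ghvDist G G' < ε → ∀ x : G.carrier, dist x G.root ≤ R →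
      ∃ y : G'.carrier, dist y G'.root < dist x G.root + 2 * δ ∧
        ∀ u, dist x G.root + 2 * δ + u ≤ R → G'.vol (Metric.closedBall y u)
          ≤ G.vol (Metric.closedBall x (u + 2 * δ)) + ENNReal.ofReal δ := by
  obtain ⟨ε, hε, H⟩ := exists_ghpDist_restrict_lt R δ hR hδ
  refine ⟨ε, hε, fun G G' h x hx => ?_⟩
  obtain ⟨s, hs, hsδ⟩ := H G G' h
  obtain ⟨Z, _, _, _, f₁, f₂, h₁, h₂, h₃, h₄, h₅⟩ := levyProkhorov_data_of_ghpDist_lt hsδ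
  let x' : (G.restrict s).carrier := ⟨x, hx.trans hs⟩
  obtain ⟨-, ⟨y, rfl⟩, hy⟩ := Metric.exists_edist_lt_of_hausdorffEDist_lt (mem_range_self x') h₃
  have hy' : dist (f₁ x') (f₂ y) < δ := by
    rwa [edist_dist, ENNReal.ofReal_lt_ofReal_iff hδ] at hy
  have h₄' : dist (f₁ (G.restrict s).root) (f₂ (G'.restrict s).root) < δ := by
    rwa [edist_dist, ENNReal.ofReal_lt_ofReal_iff hδ] at h₄
  have hroot : dist (G'.restrictVal s y) G'.root < dist x G.root + 2 * δ := by
    have e₁ : dist (f₁ x') (f₁ (G.restrict s).root) = dist x G.root := h₁.dist_eq _ _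
    have e₂ : dist (f₂ y) (f₂ (G'.restrict s).root) = dist (G'.restrictVal s y) G'.root :=
      h₂.dist_eq _ _
    have := dist_triangle4 (f₂ y) (f₁ x') (f₁ (G.restrict s).root) (f₂ (G'.restrict s).root)
    rw [dist_comm (f₂ y) (f₁ x')] at this
    linarith
  refine ⟨G'.restrictVal s y, hroot, fun u hu => ?_⟩
  rw [levyProkhorovEDist_comm] at h₅
  rw [edist_comm] at hy
  exact vol_closedBall_le_of_embedding h₂ h₁ hδ h₅ y x' hy u (by linarith)

/-- The infimum over `x ∈ B(ρ, r)` of the volumes of the closed balls of radius `u` around `x`. -/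
def minVol (G : RMSpace.{u}) (r u : ℝ) : ℝ≥0∞ :=
  ⨅ x ∈ Metric.ball G.root r, G.vol (Metric.closedBall x u)

theorem minVol_le (G : RMSpace.{u}) {x : G.carrier} {r : ℝ} (hx : x ∈ Metric.ball G.root r)
    (u : ℝ) : G.minVol r u ≤ G.vol (Metric.closedBall x u) :=
  iInf₂_le (f := fun x (_ : x ∈ Metric.ball G.root r) => G.vol (Metric.closedBall x u)) x hx

/-! ### Upper semicontinuity of the minimal volume of balls -/

theorem exists_vol_closedBall_add_lt (G : RMSpace.{u}) (x : G.carrier) (u : ℝ) {t : ℝ≥0∞}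
    (h : G.vol (Metric.closedBall x u) < t) {η : ℝ} (hη : 0 < η) : ∃ δ ∈ Ioo 0 η,
      G.vol (Metric.closedBall x (u + 2 * δ)) + ENNReal.ofReal δ < t := by
  have h1 : Tendsto (fun d => G.vol (Metric.closedBall x d)) (𝓝[>] u)
      (𝓝 (G.vol (⋂ d > u, Metric.closedBall x d))) :=
    tendsto_measure_biInter_gt (fun _ _ => Metric.isClosed_closedBall.nullMeasurableSet)
      (fun _ _ _ hij => Metric.closedBall_subset_closedBall hij)
      ⟨u + 1, by linarith, (isCompact_closedBall x _).measure_lt_top.ne⟩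
  have e : ⋂ d > u, Metric.closedBall x d = Metric.closedBall x u := by
    ext z
    simp only [mem_iInter, Metric.mem_closedBall]
    exact ⟨fun H => le_of_forall_gt_imp_ge_of_dense H, fun H d hd => H.trans (le_of_lt hd)⟩
  rw [e] at h1
  have h2 : Tendsto (fun δ : ℝ => u + 2 * δ) (𝓝[>] 0) (𝓝[>] u) := by
    refine tendsto_nhdsWithin_iff.2 ⟨?_, ?_⟩
    · exact ((by fun_prop : Continuous fun δ : ℝ => u + 2 * δ).tendsto' 0 u (by simp)).mono_left
        nhdsWithin_le_nhds
    · filter_upwards [self_mem_nhdsWithin] with δ hδ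
      rw [mem_Ioi] at hδ ⊢
      linarith
  have h3 : Tendsto (fun δ : ℝ => ENNReal.ofReal δ) (𝓝[>] 0) (𝓝 0) :=
    (ENNReal.continuous_ofReal.tendsto' 0 0 (by simp)).mono_left nhdsWithin_le_nhds
  have h4 := (h1.comp h2).add h3
  rw [add_zero] at h4
  obtain ⟨δ, h5, h6⟩ := ((h4.eventually_lt_const h).and (Ioo_mem_nhdsGT hη)).exists
  exact ⟨δ, h6, h5⟩

/-- `minVol · r u` is upper semicontinuous. -/
theorem isOpen_minVol_lt (r u : ℝ) (t : ℝ≥0∞) : IsOpen {G : RMSpace.{u} | G.minVol r u < t} := by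
  intro G hG
  simp only [mem_ofPred_eq, minVol, iInf_lt_iff, Metric.mem_ball] at hG
  obtain ⟨x, hx, hxt⟩ := hG
  obtain ⟨δ, hδ, hδt⟩ := exists_vol_closedBall_add_lt G x u hxt
    (η := (r - dist x G.root) / 2) (by linarith)
  obtain ⟨hδ0, hδr⟩ := hδ
  have hr : 0 < r := dist_nonneg.trans_lt hx
  obtain ⟨ε, hε, H⟩ := exists_forall_vol_closedBall_le (r + |u|) δ (by positivity) hδ0
  refine ⟨ε, hε, fun G' h => ?_⟩
  obtain ⟨y, hy, hyu⟩ := H G G' h x (by linarith [abs_nonneg u])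
  have := hyu u (by linarith [le_abs_self u])
  have hyr : y ∈ Metric.ball G'.root r := Metric.mem_ball.2 (by linarith)
  exact (minVol_le G' hyr u).trans_lt (this.trans_lt hδt)

/-- The volume event is closed, for arbitrary bounds `w` and an arbitrary set `T` of radii. -/
theorem isClosed_forall_le_minVol (T : Set ℝ) (w : ℝ → ℝ≥0∞) (r : ℝ) :
    IsClosed {G : RMSpace.{u} | ∀ u ∈ T, w u ≤ G.minVol r u} := by
  simp only [ofPred_forall]
  refine isClosed_iInter fun u => isClosed_iInter fun _ => ?_
  simpa only [← isOpen_compl_iff, compl_ofPred, not_le] using isOpen_minVol_lt r u (w u)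

/-! ### A continuous functional of the volumes of balls around the root -/

/-- A continuous functional that detects whether the volume of the balls around the root becomes
of order `M`: the infimum over `s ≥ 0` of `s + (M - μ(D(ρ, s)))⁺`. -/
def volumeProfile (M : ℝ≥0) (G : RMSpace.{u}) : ℝ≥0∞ :=
  ⨅ s : ℝ≥0, (s : ℝ≥0∞) + ((M : ℝ≥0∞) - G.vol (Metric.closedBall G.root s))

theorem volumeProfile_le (M : ℝ≥0) (G : RMSpace.{u}) : G.volumeProfile M ≤ M :=
  (iInf_le _ 0).trans (by simp)

/-- Comparison of the volumes of balls up to radius `M` suffices, because the terms of the infimum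
with `s ≥ M` are at least `M`, which bounds `volumeProfile M` of every space. -/
theorem volumeProfile_le_add {M δ : ℝ≥0} {G G' : RMSpace.{u}}
    (h : ∀ u ≤ (M : ℝ), G.vol (Metric.closedBall G.root u)
        ≤ G'.vol (Metric.closedBall G'.root (u + 2 * δ)) + δ) :
    G'.volumeProfile M ≤ G.volumeProfile M + 3 * δ := by
  conv_rhs => rw [volumeProfile, ENNReal.iInf_add]
  refine le_iInf fun s => ?_
  rcases le_total s M with hs | hs
  · have h1 := h s (by exact_mod_cast hs)
    calc G'.volumeProfile M ≤ ((s + 2 * δ : ℝ≥0) : ℝ≥0∞)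
          + (M - G'.vol (Metric.closedBall G'.root (s + 2 * δ : ℝ≥0))) := iInf_le _ _
      _ ≤ ((s + 2 * δ : ℝ≥0) : ℝ≥0∞) + ((M - G.vol (Metric.closedBall G.root s)) + δ) := by
        gcongr
        rw [tsub_le_iff_right]
        calc (M : ℝ≥0∞) ≤ (M - G.vol (Metric.closedBall G.root s))
              + G.vol (Metric.closedBall G.root s) := le_tsub_add
          _ ≤ _ := by
            rw [add_assoc, add_comm (δ : ℝ≥0∞)]
            gcongr
            simpa using h1
      _ = _ := by push_cast; ring
  · refine (volumeProfile_le M G').trans ?_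
    have : (M : ℝ≥0∞) ≤ s := by exact_mod_cast hs
    exact this.trans (by rw [add_assoc]; exact le_self_add)

theorem continuous_toReal_volumeProfile (M : ℝ≥0) :
    Continuous fun G : RMSpace.{u} => (G.volumeProfile M).toReal := by
  have hfin : ∀ G : RMSpace.{u}, G.volumeProfile M ≠ ∞ := fun G =>
    ((volumeProfile_le M G).trans_lt ENNReal.coe_lt_top).ne
  refine continuous_def.2 fun V hV G hG => ?_
  obtain ⟨η, hη, hηV⟩ := Metric.isOpen_iff.1 hV _ hG
  obtain ⟨ε, hε, H⟩ := exists_forall_vol_closedBall_root_le (M : ℝ) (η / 4) M.2 (by positivity)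
  refine ⟨ε, hε, fun G' h => hηV ?_⟩
  lift η to ℝ≥0 using hη.le
  have e : ENNReal.ofReal (η / 4) = ((η / 4 : ℝ≥0) : ℝ≥0∞) := by
    rw [← ENNReal.ofReal_coe_nnreal]; simp
  simp only [e] at H
  have h1 : (G'.volumeProfile M).toReal ≤ (G.volumeProfile M).toReal + 3 * (η / 4) := by
    have := ENNReal.toReal_mono (by finiteness [hfin G]) (volumeProfile_le_add (δ := η / 4)
      fun u hu => by simpa using (H G G' h u hu).1)
    rwa [ENNReal.toReal_add (hfin G) (by finiteness), ENNReal.toReal_mul,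
      ENNReal.coe_toReal] at this
  have h2 : (G.volumeProfile M).toReal ≤ (G'.volumeProfile M).toReal + 3 * (η / 4) := by
    have := ENNReal.toReal_mono (by finiteness [hfin G']) (volumeProfile_le_add (δ := η / 4)
      fun u hu => by simpa using (H G G' h u hu).2)
    rwa [ENNReal.toReal_add (hfin G') (by finiteness), ENNReal.toReal_mul,
      ENNReal.coe_toReal] at this
  have : (0 : ℝ) < η := hη
  rw [Metric.mem_ball, Real.dist_eq, abs_lt]
  constructor <;> linarith

/-! ### Covering numbers -/

/-- The closed balls of radius `η / 2` around the points of an `η`-separated set are disjoint, and a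
maximal such set is a cover. -/
theorem coveringNumber_mul_minVol_le (G : RMSpace.{u}) {r r' : ℝ} (hr : r < r') {η : ℝ≥0}
    (hη : 0 < η) (hη1 : η ≤ 1) :
    ((Metric.coveringNumber η (closure (Metric.ball G.root r)) : ℕ∞) : ℝ≥0∞) * G.minVol r' (η / 2)
      ≤ G.vol (Metric.closedBall G.root (r + 1)) := by
  set A := closure (Metric.ball G.root r)
  have hA : A ⊆ Metric.closedBall G.root r := Metric.closure_ball_subset_closedBall
  have hAc : IsCompact A := (isCompact_closedBall G.root r).of_isClosed_subset isClosed_closure hA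
  have hfin : Metric.packingNumber η A ≠ ⊤ := by
    obtain ⟨N, hN, hNfin, hcov⟩ := Metric.exists_finite_isCover_of_isCompact
      (ε := η / 2) (by positivity) hAc
    have h1 := Metric.packingNumber_two_mul_le_externalCoveringNumber (η / 2) A
    rw [mul_div_cancel₀ _ (two_ne_zero)] at h1
    exact ((h1.trans hcov.externalCoveringNumber_le_encard).trans_lt hNfin.encard_lt_top).ne
  obtain ⟨C, hCA, -, hCsep, hCcard⟩ := Metric.exists_set_encard_eq_packingNumber hfin
  have hle : Metric.coveringNumber η A ≤ C.encard :=
    (Metric.coveringNumber_le_packingNumber η A).trans hCcard.ge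
  have hη1' : (η : ℝ) ≤ 1 := by exact_mod_cast hη1
  have hη' : (0 : ℝ) < η := by exact_mod_cast hη
  calc _ ≤ (C.encard : ℝ≥0∞) * G.minVol r' (η / 2) := by
        gcongr
    _ = ∑' _ : C, G.minVol r' (η / 2) := (ENNReal.tsum_set_const _ _).symm
    _ ≤ ∑' x : C, G.vol (Metric.closedBall x.1 (η / 2)) := by
        refine ENNReal.tsum_le_tsum fun x => minVol_le G ?_ _
        have := hA (hCA x.2)
        rw [Metric.mem_closedBall] at this
        rw [Metric.mem_ball]
        linarith
    _ ≤ G.vol (⋃ x : C, Metric.closedBall x.1 (η / 2)) := by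
        refine tsum_meas_le_meas_iUnion_of_disjoint _
          (fun _ => Metric.isClosed_closedBall.measurableSet) fun x y hxy => ?_
        refine Metric.closedBall_disjoint_closedBall ?_
        have h : (η : ℝ≥0∞) < edist x.1 y.1 := hCsep x.2 y.2 (fun h => hxy (Subtype.ext h))
        rw [edist_dist, ← ENNReal.ofReal_coe_nnreal,
          ENNReal.ofReal_lt_ofReal_iff_of_nonneg hη'.le] at h
        linarith
    _ ≤ _ := by
        refine measure_mono (iUnion_subset fun x z hz => ?_)
        have h1 := hA (hCA x.2)
        have := dist_triangle z x.1 G.root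
        rw [Metric.mem_closedBall] at h1 hz ⊢
        linarith

theorem coveringNumber_le_of_count_le (G : RMSpace.{u}) (r : ℝ) (η : ℝ≥0) {c : ℝ≥0∞}
    (hG : Measure.count ≤ c • G.vol) :
    ((Metric.coveringNumber η (closure (Metric.ball G.root r)) : ℕ∞) : ℝ≥0∞)
      ≤ c * G.vol (Metric.closedBall G.root (r + 1)) := by
  calc _ ≤ ((closure (Metric.ball G.root r)).encard : ℝ≥0∞) :=
        ENat.toENNReal_le.2 (Metric.coveringNumber_le_encard_self _)
    _ = Measure.count (closure (Metric.ball G.root r)) :=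
        (Measure.count_apply isClosed_closure.measurableSet).symm
    _ ≤ c * G.vol (closure (Metric.ball G.root r)) := hG _
    _ ≤ _ := by
        gcongr
        exact Metric.closure_ball_subset_closedBall.trans
          (Metric.closedBall_subset_closedBall (by linarith))

/-! ### Tightness of the volume of balls around the root -/

theorem volumeProfile_mono (G : RMSpace.{u}) : Monotone fun M : ℝ≥0 => G.volumeProfile M :=
  fun M M' h => iInf_mono fun s => by gcongr

theorem toReal_volumeProfile_le (G : RMSpace.{u}) {M r : ℝ≥0}
    (h : M ≤ G.vol (Metric.closedBall G.root r)) : (G.volumeProfile M).toReal ≤ r := by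
  refine ENNReal.toReal_le_of_le_ofReal r.2 ((iInf_le _ r).trans ?_)
  rw [tsub_eq_zero_of_le h, add_zero]
  exact (ENNReal.ofReal_coe_nnreal).ge

/-- For a fixed space, `volumeProfile M` exceeds `r` once `M` exceeds `μ(D(ρ, r + 1)) + r + 1`. -/
theorem exists_lt_toReal_volumeProfile (G : RMSpace.{u}) (r : ℝ≥0) :
    ∃ M : ℕ, r < (G.volumeProfile M).toReal := by
  have hV : G.vol (Metric.closedBall G.root (r + 1)) + (r + 1 : ℝ≥0) ≠ ∞ := by
    have := (isCompact_closedBall G.root ((r : ℝ) + 1)).measure_lt_top (μ := G.vol)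
    finiteness
  obtain ⟨M, hM⟩ := ENNReal.exists_nat_gt hV
  refine ⟨M, ?_⟩
  by_contra! h
  have h1 : G.volumeProfile M < (r + 1 : ℝ≥0) := by
    have h2 : G.volumeProfile M ≠ ∞ := ((volumeProfile_le _ G).trans_lt ENNReal.coe_lt_top).ne
    refine ((ENNReal.le_ofReal_iff_toReal_le h2 r.2).2 h).trans_lt ?_
    rw [ENNReal.ofReal_eq_coe_nnreal r.2]
    exact ENNReal.coe_lt_coe.2 (lt_add_one r)
  obtain ⟨s, hs⟩ := iInf_lt_iff.1 h1
  have hsr : s ≤ r + 1 := by exact_mod_cast (le_self_add.trans_lt hs).le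
  have h3 : (M : ℝ≥0∞) ≤ G.vol (Metric.closedBall G.root s) + (r + 1 : ℝ≥0) := by
    rw [← tsub_le_iff_left]
    exact (le_add_self.trans hs.le)
  refine absurd hM (not_lt.2 (h3.trans ?_))
  gcongr
  exact_mod_cast hsr

variable {Ω : ℕ → Type v} [∀ n, MeasurableSpace (Ω n)]
  {P : ∀ n, Measure (Ω n)} [∀ n, IsProbabilityMeasure (P n)]
  {Ω' : Type w} [MeasurableSpace Ω'] {P' : Measure Ω'} [IsProbabilityMeasure P']
  {G' : Ω' → RMSpace.{u}} {G : ∀ n, Ω n → RMSpace.{u}}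

/-- If random spaces converge in distribution, then the volumes of the balls of a fixed radius
around their roots are tight. -/
theorem _root_.MeasureTheory.TendstoInDistribution.eventually_measure_vol_ge_le
    (h : TendstoInDistribution G atTop G' P P') (r : ℝ≥0) {η : ℝ≥0∞} (hη : 0 < η) :
    ∃ M : ℕ, ∀ᶠ n in atTop, P n {ω | M ≤ (G n ω).vol (Metric.closedBall (G n ω).root r)} ≤ η := by
  have hmeas (M : ℕ) : NullMeasurableSet {ω | ((G' ω).volumeProfile M).toReal ≤ r} P' :=
    ((continuous_toReal_volumeProfile M).measurable.comp_aemeasurable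
      h.aemeasurable_limit).nullMeasurableSet_preimage measurableSet_Iic
  have hanti : Antitone fun M : ℕ => {ω | ((G' ω).volumeProfile M).toReal ≤ r} := by
    intro M M' hM ω hω
    refine (ENNReal.toReal_mono ?_ (volumeProfile_mono (G' ω) (by exact_mod_cast hM))).trans hω
    exact ((volumeProfile_le _ (G' ω)).trans_lt ENNReal.coe_lt_top).ne
  have hempty : ⋂ M : ℕ, {ω | ((G' ω).volumeProfile M).toReal ≤ r} = ∅ := by
    refine eq_empty_of_forall_notMem fun ω hω => ?_
    obtain ⟨M, hM⟩ := exists_lt_toReal_volumeProfile (G' ω) r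
    exact absurd (mem_iInter.1 hω M) (not_le.2 hM)
  have hlim := tendsto_measure_iInter_atTop hmeas hanti ⟨0, measure_ne_top _ _⟩
  rw [hempty, measure_empty] at hlim
  obtain ⟨M, hM⟩ := (hlim.eventually_lt_const hη).exists
  refine ⟨M, ?_⟩
  have hlt := (h.limsup_measure_le_of_continuous (continuous_toReal_volumeProfile M) r).trans_lt hM
  filter_upwards [eventually_lt_of_limsup_lt hlt] with n hn
  refine (measure_mono fun ω hω => ?_).trans hn.le
  exact toReal_volumeProfile_le _ (by simpa using hω)

/-! ### The entropy condition from a bound of the entropy on likely events -/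

/-- It suffices to bound, on events of probability close to `1`, the tail of the entropy series by
`μ(D(ρ, r + 1))²` times a deterministic quantity that tends to `0`, because `μ(D(ρ, r + 1))` is
tight. -/
theorem tendsto_limsup_measure_entropyTail
    (h : TendstoInDistribution G atTop G' P P') {r α : ℝ} (hr : 0 < r)
    (H : ∀ η : ℝ, 0 < η → ∃ (S : ℕ → ℕ → ℝ≥0∞) (m₀ : ℕ),
      Tendsto (fun m => limsup (fun n => S n m) atTop) atTop (𝓝 0) ∧
      ∀ᶠ n in atTop, P n {ω | ¬ ∀ m ≥ m₀, (G n ω).entropyTail r α m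
        ≤ (G n ω).vol (Metric.closedBall (G n ω).root (r + 1)) ^ 2 * S n m}
        ≤ ENNReal.ofReal η) {ε : ℝ} (hε : 0 < ε) :
    Tendsto (fun m : ℕ => limsup (fun n : ℕ =>
      P n {ω | ENNReal.ofReal ε ≤ (G n ω).entropyTail r α m}) atTop) atTop (𝓝 0) := by
  rw [ENNReal.tendsto_nhds_zero]
  intro δ hδ
  obtain ⟨η, hη, hηδ⟩ : ∃ η : ℝ, 0 < η ∧ ENNReal.ofReal η + ENNReal.ofReal η ≤ δ := by
    obtain ⟨d, hd, hdδ⟩ := ENNReal.lt_iff_exists_nnreal_btwn.1 hδ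
    have hd' : 0 < d := by exact_mod_cast hd
    refine ⟨d / 2, by positivity, ?_⟩
    rw [← ENNReal.ofReal_add (by positivity) (by positivity), add_halves, ENNReal.ofReal_coe_nnreal]
    exact hdδ.le
  obtain ⟨S, m₀, hS, hSn⟩ := H η hη
  obtain ⟨M, hM⟩ := h.eventually_measure_vol_ge_le (⟨r + 1, by positivity⟩ : ℝ≥0)
    (ENNReal.ofReal_pos.2 hη)
  -- `M ^ 2 + 1` in place of `M ^ 2`, because `M` may be `0`.
  have hc : 0 < ENNReal.ofReal ε / (M ^ 2 + 1) :=
    ENNReal.div_pos (ENNReal.ofReal_pos.2 hε).ne' (by finiteness)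
  filter_upwards [eventually_ge_atTop m₀, hS.eventually_lt_const hc] with m hm hSm
  refine limsup_le_of_le (by isBoundedDefault) ?_
  filter_upwards [hSn, hM, eventually_lt_of_limsup_lt hSm] with n h1 h2 h3
  refine le_trans (le_trans (measure_mono fun ω hω => ?_) (measure_union_le _ _))
    ((add_le_add h1 h2).trans hηδ)
  by_contra hcon
  simp only [mem_union, mem_ofPred_eq, not_or, not_not, not_le] at hcon hω
  obtain ⟨h4, h5⟩ := hcon
  refine absurd (hω.trans (h4 m hm)) (not_le.2 ?_)
  calc _ ≤ ((M : ℝ≥0∞) ^ 2 + 1) * S n m := by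
        gcongr
        exact le_trans (pow_le_pow_left' h5.le 2) le_self_add
    _ < ENNReal.ofReal ε := by
        rw [mul_comm]
        exact (ENNReal.lt_div_iff_mul_lt (by left; positivity) (by left; finiteness)).1 h3

/-- An event of the form "the volumes of all small balls are bounded below" is measurable up to a
null set, so that a lower bound of its probability bounds the probability of its complement. -/
theorem eventually_measure_not_le (h : ∀ n, AEMeasurable (G n) (P n)) (T : ℕ → Set ℝ)
    (v : ℕ → ℝ → ℝ≥0∞) (r : ℝ) {η : ℝ} (hη : 0 < η) {ε : ℝ} (hεη : ε < η)
    (hP : ENNReal.ofReal (1 - ε)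
      ≤ liminf (fun n => P n {ω | ∀ u ∈ T n, v n u ≤ (G n ω).minVol r u}) atTop) :
    ∀ᶠ n in atTop, P n {ω | ¬ ∀ u ∈ T n, v n u ≤ (G n ω).minVol r u} ≤ ENNReal.ofReal η := by
  rcases le_or_gt 1 η with h1 | h1
  · filter_upwards with n
    exact prob_le_one.trans (by simpa using h1)
  have hlt : ENNReal.ofReal (1 - η) < ENNReal.ofReal (1 - ε) :=
    (ENNReal.ofReal_lt_ofReal_iff (by linarith)).2 (by linarith)
  filter_upwards [eventually_lt_of_lt_liminf (hlt.trans_le hP)] with n hn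
  have hm : NullMeasurableSet {ω | ∀ u ∈ T n, v n u ≤ (G n ω).minVol r u} (P n) :=
    (h n).nullMeasurableSet_preimage (isClosed_forall_le_minVol (T n) (v n) r).measurableSet
  have := prob_compl_eq_one_sub₀ hm
  rw [compl_ofPred] at this
  rw [this, tsub_le_iff_left]
  calc (1 : ℝ≥0∞) = ENNReal.ofReal (1 - η) + ENNReal.ofReal η := by
        rw [← ENNReal.ofReal_add (by linarith) hη.le]; simp
    _ ≤ _ := by gcongr

/-! ### Bounds for the terms of the entropy series -/

/-- The term of the entropy series at a scale at which volumes are bounded below. -/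
theorem entropy_term_le_of_le_minVol (G : RMSpace.{u}) {r r' : ℝ} (hr : r < r') {x y v : ℝ} {l : ℕ}
    (hv : 0 < v) (hvol : ENNReal.ofReal v ≤ G.minVol r' (2⁻¹ ^ (l + 1))) (h : y + l ≤ x) :
    ((Metric.coveringNumber ((2 : ℝ≥0)⁻¹ ^ l) (closure (Metric.ball G.root r)) : ℕ∞) : ℝ≥0∞) ^ 2
        * ENNReal.ofReal (Real.exp (-x))
      ≤ G.vol (Metric.closedBall G.root (r + 1)) ^ 2
        * ENNReal.ofReal (v⁻¹ ^ 2 * Real.exp (-y)) := by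
  have hN := G.coveringNumber_mul_minVol_le hr (η := 2⁻¹ ^ l) (by positivity)
    (pow_le_one₀ (by positivity) (by norm_num))
  have e : (((2 : ℝ≥0)⁻¹ ^ l : ℝ≥0) : ℝ) / 2 = 2⁻¹ ^ (l + 1) := by
    push_cast; rw [pow_succ]; ring
  rw [e] at hN
  have hN' := (mul_le_mul_right hvol _).trans hN
  rw [← ENNReal.le_div_iff_mul_le (by left; simpa using hv) (by left; finiteness),
    div_eq_mul_inv, ← ENNReal.ofReal_inv_of_pos hv] at hN'
  have hl : (0 : ℝ) ≤ l := l.cast_nonneg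
  refine (sq_mul_ofReal_exp_le hN' (y := y) (z := 0) (by linarith)).trans ?_
  rw [neg_zero, Real.exp_zero, ENNReal.ofReal_one, mul_one,
    ENNReal.ofReal_mul (by positivity), ENNReal.ofReal_pow (by positivity)]

/-- The term of the entropy series at a scale below the one at which volumes are controlled, for a
space whose measure is a multiple of the counting measure. -/
theorem entropy_term_le_of_count_le (G : RMSpace.{u}) (r : ℝ) {b x y : ℝ} {l : ℕ} (hb : 0 ≤ b)
    (hG : Measure.count ≤ ENNReal.ofReal b • G.vol) (h : y + l ≤ x) :
    ((Metric.coveringNumber ((2 : ℝ≥0)⁻¹ ^ l) (closure (Metric.ball G.root r)) : ℕ∞) : ℝ≥0∞) ^ 2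
        * ENNReal.ofReal (Real.exp (-x))
      ≤ G.vol (Metric.closedBall G.root (r + 1)) ^ 2
        * (ENNReal.ofReal (b ^ 2 * Real.exp (-y)) * ENNReal.ofReal (Real.exp (-l))) := by
  have hN := G.coveringNumber_le_of_count_le r (2⁻¹ ^ l) hG
  rw [mul_comm] at hN
  refine (sq_mul_ofReal_exp_le hN h).trans ?_
  rw [ENNReal.ofReal_mul (by positivity), ENNReal.ofReal_pow hb]

theorem entropyTail_le (G : RMSpace.{u}) {r α : ℝ} {m : ℕ} {V : ℝ≥0∞} {w : ℕ → ℝ≥0∞}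
    (h : ∀ l ≥ m, ((Metric.coveringNumber ((2 : ℝ≥0)⁻¹ ^ l)
        (closure (Metric.ball G.root r)) : ℕ∞) : ℝ≥0∞) ^ 2
        * ENNReal.ofReal (Real.exp (-(2 : ℝ) ^ (α * (l : ℕ)))) ≤ V * w l) :
    G.entropyTail r α m ≤ V * ∑' l : {l : ℕ // m ≤ l}, w l := by
  rw [← ENNReal.tsum_mul_left]
  exact ENNReal.tsum_le_tsum fun l => h l.1 l.2

/-! ### Rescaling -/

theorem minVol_rescale (G : RMSpace.{u}) {a : ℝ} (ha : 0 < a) (b r u : ℝ) :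
    (G.rescale a⁻¹ b (inv_pos.2 ha)).minVol r u = ⨅ x ∈ Metric.ball G.root (a * r),
      ENNReal.ofReal b * G.vol (Metric.closedBall x (a * u)) := by
  have h1 (x : G.carrier) : @Metric.ball G.carrier
      (scaledMetric G.metric a⁻¹ (inv_pos.2 ha)).toPseudoMetricSpace x r
      = Metric.ball x (a * r) := by
    ext y
    change a⁻¹ * dist y x < r ↔ dist y x < a * r
    rw [inv_mul_lt_iff₀ ha]
  have h2 (x : G.carrier) : @Metric.closedBall G.carrier
      (scaledMetric G.metric a⁻¹ (inv_pos.2 ha)).toPseudoMetricSpace x u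
      = Metric.closedBall x (a * u) := by
    ext y
    change a⁻¹ * dist y x ≤ u ↔ dist y x ≤ a * u
    rw [inv_mul_le_iff₀ ha]
  change ⨅ x ∈ @Metric.ball G.carrier
      (scaledMetric G.metric a⁻¹ (inv_pos.2 ha)).toPseudoMetricSpace G.root r,
    ENNReal.ofReal b * G.vol (@Metric.closedBall G.carrier
      (scaledMetric G.metric a⁻¹ (inv_pos.2 ha)).toPseudoMetricSpace x u) = _
  rw [h1]
  simp only [h2]

theorem count_le_rescale (G : RMSpace.{u}) {a b : ℝ} (ha : 0 < a) (hb : 0 < b)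
    (hG : G.vol = Measure.count) :
    Measure.count ≤ ENNReal.ofReal b • (G.rescale a b⁻¹ ha).vol := by
  refine Measure.le_iff.2 fun s _ => ?_
  change (Measure.count : Measure G.carrier) s
    ≤ ENNReal.ofReal b * (ENNReal.ofReal b⁻¹ * G.vol s)
  rw [← mul_assoc, ← ENNReal.ofReal_mul hb.le, mul_inv_cancel₀ hb.ne', ENNReal.ofReal_one, one_mul,
    hG]

/-! ### The entropy condition from volume bounds -/

theorem annealedEntropyCondition_of_volumeCondition {G : ∀ n, Ω n → RMSpace.{u}}
    (h : TendstoInDistribution G atTop G' P P') (hvol : VolumeCondition P G) :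
    AnnealedEntropyCondition P G := by
  obtain ⟨ρ, β, -, hρ, hβ, H⟩ := hvol
  intro r hr
  obtain ⟨k, hk⟩ := (hρ.eventually_gt_atTop r).exists
  obtain ⟨hβ0, hβ1⟩ := hβ k
  refine ⟨(β k + 1 / 2) / 2, ⟨by linarith, by linarith⟩, fun ε hε => ?_⟩
  obtain ⟨m₀, hm₀⟩ := exists_forall_two_rpow_add_le hβ0 (α := (β k + 1 / 2) / 2) (by linarith)
  refine tendsto_limsup_measure_entropyTail h hr (fun η hη => ?_) hε
  obtain ⟨v, -, hv0, hvP, hvS⟩ := H (η / 2) (by positivity)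
  refine ⟨_, m₀, hvS k, ?_⟩
  filter_upwards [eventually_measure_not_le h.forall_aemeasurable (fun _ => Ioi 0)
    (fun n u => ENNReal.ofReal (v n k u)) (ρ k) hη (half_lt_self hη) (hvP k)] with n hn
  refine (measure_mono fun ω => not_imp_not.2 fun hω m hm => ?_).trans hn
  refine (entropyTail_le _ fun l hl => entropy_term_le_of_le_minVol _ hk
    (hv0 n k _ (by positivity)) (hω _ (by simp)) (hm₀ l (hm.trans hl))).trans ?_
  exact mul_le_mul_right (tsum_succ_le (fun l => ENNReal.ofReal ((v n k (2⁻¹ ^ l))⁻¹ ^ 2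
    * Real.exp (-(2 : ℝ) ^ (β k * (l : ℕ))))) m) _

theorem annealedEntropyCondition_of_graphVolumeCondition {H : ∀ n, Ω n → RMSpace.{u}}
    {a b : ℕ → ℝ} (ha : ∀ n, 0 < a n) (hb : ∀ n, 0 < b n)
    (hH : ∀ n, ∀ᵐ ω ∂P n, (H n ω).vol = Measure.count)
    (h : TendstoInDistribution
      (fun n ω => (H n ω).rescale (a n)⁻¹ (b n)⁻¹ (inv_pos.2 (ha n))) atTop G' P P')
    (hvol : GraphVolumeCondition P H a b) :
    AnnealedEntropyCondition P
      (fun n ω => (H n ω).rescale (a n)⁻¹ (b n)⁻¹ (inv_pos.2 (ha n))) := by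
  obtain ⟨ρ, c, β, -, hρ, hc, hβ, hbc, HH⟩ := hvol
  intro r hr
  obtain ⟨k, hk⟩ := (hρ.eventually_gt_atTop r).exists
  obtain ⟨hβ0, hβ1⟩ := hβ k
  refine ⟨(β k + 1 / 2) / 2, ⟨by linarith, by linarith⟩, fun ε hε => ?_⟩
  obtain ⟨m₀, hm₀⟩ := exists_forall_two_rpow_add_le hβ0 (α := (β k + 1 / 2) / 2) (by linarith)
  refine tendsto_limsup_measure_entropyTail h hr (fun η hη => ?_) hε
  obtain ⟨c', v, hc', -, hv0, hvP, hvS⟩ := HH (η / 2) (by positivity)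
  obtain ⟨m₁, hm₁⟩ := exists_pow_lt_of_lt_one (hc' k) (y := (2⁻¹ : ℝ)) (by norm_num)
  set A : ℕ → ℝ≥0∞ := fun l => ENNReal.ofReal ((v k (2⁻¹ ^ l))⁻¹ ^ 2
    * Real.exp (-(2 : ℝ) ^ (β k * (l : ℕ))))
  set B : ℕ → ℝ≥0∞ := fun n => ENNReal.ofReal (b n ^ 2 * Real.exp (-(c n k ^ β k)))
  set K : ℝ≥0∞ := ∑' l : ℕ, ENNReal.ofReal (Real.exp (-l))
  have hKtop : K ≠ ∞ := Real.summable_exp_neg_nat.tsum_ofReal_ne_top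
  have hB0 : Tendsto B atTop (𝓝 0) :=
    (ENNReal.continuous_ofReal.tendsto' 0 0 ENNReal.ofReal_zero).comp (hbc k)
  refine ⟨fun n m => (∑' l : {l : ℕ // m ≤ l}, A l) + B n * K, max m₀ m₁, ?_, ?_⟩
  · have hlim (m : ℕ) : limsup (fun n => (∑' l : {l : ℕ // m ≤ l}, A l) + B n * K) atTop
        = ∑' l : {l : ℕ // m ≤ l}, A l := by
      refine Tendsto.limsup_eq ?_
      simpa using (ENNReal.Tendsto.mul_const hB0 (Or.inr hKtop)).const_add
        (∑' l : {l : ℕ // m ≤ l}, A l)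
    simp only [hlim]
    exact tendsto_tsum_ge (hvS k).tsum_ofReal_ne_top
  · have hP := hvP k
    simp only [← minVol_rescale _ (ha _)] at hP
    filter_upwards [eventually_measure_not_le h.forall_aemeasurable
      (fun n => Ioo (c n k)⁻¹ (c' k)) (fun n u => ENNReal.ofReal (v k u)) (ρ k) hη
      (half_lt_self hη) hP] with n hn
    refine (measure_mono_ae ?_).trans hn
    filter_upwards [hH n] with ω hcount
    refine not_imp_not.2 fun hω m hm => ?_
    let X : RMSpace.{u} := (H n ω).rescale (a n)⁻¹ (b n)⁻¹ (inv_pos.2 (ha n))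
    refine (X.entropyTail_le (V := X.vol (Metric.closedBall X.root (r + 1)) ^ 2)
      (w := fun l => A (l + 1) + B n * ENNReal.ofReal (Real.exp (-l))) fun l hl => ?_).trans ?_
    · have hl₀ := hm₀ l (((le_max_left _ _).trans hm).trans hl)
      have hl₁ : m₁ ≤ l + 1 := (((le_max_right _ _).trans hm).trans hl).trans l.le_succ
      -- At scales above `(c n k)⁻¹` the volume bound applies, below it the number of points does.
      rcases lt_or_ge (c n k)⁻¹ (2⁻¹ ^ (l + 1)) with hlt | hge
      · refine (entropy_term_le_of_le_minVol _ hk (hv0 k _ (by positivity)) (hω _ ⟨hlt, ?_⟩)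
          hl₀).trans ?_
        · exact (pow_le_pow_of_le_one (by norm_num) (by norm_num) hl₁).trans_lt hm₁
        · gcongr
          exact le_self_add
      · have hcl : c n k ^ β k ≤ 2 ^ (β k * (l + 1 : ℕ)) := by
          rw [mul_comm, Real.rpow_mul two_pos.le, Real.rpow_natCast]
          refine Real.rpow_le_rpow (hc n k).le ?_ hβ0.le
          rw [inv_pow] at hge
          exact (inv_le_inv₀ (by positivity) (hc n k)).1 hge
        refine (entropy_term_le_of_count_le _ r (hb n).le
          (count_le_rescale _ (inv_pos.2 (ha n)) (hb n) hcount) (y := c n k ^ β k)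
          (by linarith)).trans ?_
        gcongr
        exact le_add_self
    · rw [ENNReal.tsum_add, ENNReal.tsum_mul_left]
      exact mul_le_mul_right (add_le_add (tsum_succ_le A m)
        (mul_le_mul_right (ENNReal.tsum_comp_le_tsum_of_injective Subtype.val_injective _) _)) _

end RMSpace

end

theorem mainTheorem12
    {Ω : ℕ → Type v} [∀ n, MeasurableSpace (Ω n)]
    (P : ∀ n, Measure (Ω n)) [∀ n, IsProbabilityMeasure (P n)]
    {Ω' : Type w} [MeasurableSpace Ω'] (P' : Measure Ω') [IsProbabilityMeasure P']
    (G' : Ω' → RMSpace.{u}) (hG' : ∀ᵐ ω ∂P', (G' ω).IsResistanceSpace) :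
    (∀ G : ∀ n, Ω n → RMSpace.{u},
      (∀ n, ∀ᵐ ω ∂P n, (G n ω).IsEntropicResistanceSpace) →
      TendstoInDistribution G atTop G' P P' →
      VolumeCondition P G → AnnealedEntropyCondition P G) ∧
    (∀ (H : ∀ n, Ω n → RMSpace.{u}) (a b : ℕ → ℝ)
      (ha : ∀ n, 0 < a n) (_ : ∀ n, 0 < b n),
      Tendsto a atTop atTop → Tendsto b atTop atTop →
      (∀ n, ∀ᵐ ω ∂P n, (H n ω).IsResistanceSpace ∧
        Countable (H n ω).carrier ∧ (H n ω).vol = Measure.count) →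
      TendstoInDistribution
        (fun n ω => (H n ω).rescale (a n)⁻¹ (b n)⁻¹ (inv_pos.2 (ha n))) atTop G' P P' →
      GraphVolumeCondition P H a b →
      AnnealedEntropyCondition P
        (fun n ω => (H n ω).rescale (a n)⁻¹ (b n)⁻¹ (inv_pos.2 (ha n)))) :=
  ⟨fun _ _ h hvol => RMSpace.annealedEntropyCondition_of_volumeCondition h hvol,
    fun _ _ _ ha hb _ _ hH h hvol =>
      RMSpace.annealedEntropyCondition_of_graphVolumeCondition ha hb
        (fun n => (hH n).mono fun _ hω => hω.2.2) h hvol⟩
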